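/- Let agents $i=1,\dots,N$ have finite local state sets $\mathcal S^i$ and action sets $\mathcal A^i$, initial states $s_I^i\in\mathcal S^i$ and transition functions $\mathcal T^i:\mathcal S^i\times\mathcal A^i\to\Delta(\mathcal S^i)$. Let $\boldsymbol{\mathcal S}=\prod_i\mathcal S^i$, $\boldsymbol{\mathcal A}=\prod_i\mathcal A^i$, $\boldsymbol s_I=(s_I^1,\dots,s_I^N)$, with joint transitions $\boldsymbol{\mathcal T}(\boldsymbol s,\boldsymbol a,\boldsymbol y)=\prod_{i}\mathcal T^i(s^i,a^i,y^i)$, and let $\pi:\boldsymbol{\mathcal S}\to\Delta(\boldsymbol{\mathcal A})$ be a stationary joint policy. Let $\Gamma^{full}$ be the law on $(\boldsymbol{\mathcal S}\times\boldsymbol{\mathcal A})^{\mathbb N}$ of the joint path $\boldsymbol X=\boldsymbol s_0\boldsymbol a_0\boldsymbol s_1\boldsymbol a_1\dots$ with $\boldsymbol s_0=\boldsymbol s_I$, $\boldsymbol a_t\sim\pi(\boldsymbol s_t)$, $\boldsymbol s_{t+1}\sim\boldsymbol{\mathcal T}(\boldsymbol s_t,\boldsymbol a_t)$. For a deterministic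 loss time $t_{loss}\in\{0,1,2,\dots\}\cup\{\infty\}$, let $\Gamma^{img}_{t_{loss}}$ be the law of the actual joint path under the following execution (imaginary play). Each agent $i$ keeps a joint state and a joint action $(\hat{\boldsymbol s}_{t,i},\hat{\boldsymbol a}_{t,i})$, whose $i$-th components are agent $i$'s actual state and action $s^i_t,a^i_t$. At time $0$ all states are $\boldsymbol s_I$; the actual states always move by $s^i_{t+1}\sim\mathcal T^i(s^i_t,a^i_t)$, independently over agents. At times $t<t_{loss}$ the agents share their states, so $\hat{\boldsymbol s}_{t,i}=\boldsymbol s_t$ for all $i$, and draw a single joint action $\boldsymbol a_t\sim\pi(\boldsymbol s_t)$, with $\hat{\boldsymbol a}_{t,i}=\boldsymbol a_t$ for all $i$. At times $t\ge t_{loss}$, independently of the other agents, each agent $i$ samples imaginary teammate states $\hat s^j_{t,i}\sim\mathcal T^j(\hat s^j_{t-1,i},\hat a^j_{t-1,i})$, $j\ne i$ (if $t=0$, it sets $\hat s^j_{0,i}=s_I^j$), draws $\hat{\boldsymbol a}_{t,i}\sim\pi(\hat{\boldsymbol s}_{t,i})$, where $\hat s^i_{t,i}=s^i_t$, and executes its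 own component $\hat a^i_{t,i}$. Let $H$ be Shannon entropy (in nats; $\infty$ for a non-discrete law) and $KL$ the Kullback–Leibler divergence, with values in $[0,\infty]$. Let $X^i=s^i_0a^i_0s^i_1a^i_1\dots$ be the path of agent $i$ under full communication, let $X^i_{<n}$ and $\boldsymbol X_{<n}$ be the parts of $X^i$ and $\boldsymbol X$ at times $0,\dots,n-1$, and define the total correlation of $\pi$ as $$C_\pi=\sup_{n\ge 0}\Big[\sum_{i=1}^N H(X^i_{<n})-H(\boldsymbol X_{<n})\Big]\in[0,\infty].$$ Then for every $t_{loss}\in\{0,1,2,\dots\}\cup\{\infty\}$, $$KL(\Gamma^{full}\,\|\,\Gamma^{img}_{t_{loss}})\le KL(\Gamma^{full}\,\|\,\Gamma^{img}_{0})=C_\pi ,$$ and, if $H(\boldsymbol X)<\infty$, then $C_\pi=\sum_{i=1}^N H(X^i)-H(\boldsymbol X)$. -/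

import Mathlib

open MeasureTheory ProbabilityTheory InformationTheory
open scoped ENNReal

/-- The data of a cooperative Markov game: agent `i` has local states `S i`, local actions `A i`,
an initial local state and a local transition function. -/
structure MarkovGame {ι : Type*} (S A : ι → Type*) where
  init : ∀ i, S i
  trans : ∀ i, S i → A i → PMF (S i)

/-- A joint state-action pair, stored agent by agent. -/
abbrev JointStep {ι : Type*} (S A : ι → Type*) : Type _ := ∀ i, S i × A i

/-- A stationary joint policy. -/
abbrev JointPolicy {ι : Type*} (S A : ι → Type*) : Type _ := (∀ i, S i) → PMF (∀ i, A i)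

noncomputable section

namespace MarkovGame

section

variable {ι : Type*} [Fintype ι] {S A : ι → Type*}
  [∀ i, Fintype (S i)] [∀ i, MeasurableSpace (S i)] [∀ i, DiscreteMeasurableSpace (S i)]
  [∀ i, Fintype (A i)] [∀ i, MeasurableSpace (A i)] [∀ i, DiscreteMeasurableSpace (A i)]

/-- The law of the next joint state: the agents move independently, each according to its own
local transition function. -/
def jointTrans (G : MarkovGame S A) (z : JointStep S A) : Measure (∀ i, S i) :=
  Measure.pi fun i => (G.trans i (z i).1 (z i).2).toMeasure

/-- The law of the pair of `s` and a joint action drawn from the policy at `s`. -/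
def actionStep (π : JointPolicy S A) (s : ∀ i, S i) : Measure (JointStep S A) :=
  (π s).toMeasure.map fun a i => (s i, a i)

/-- The law of the joint state-action pair at time `0` with communication. -/
def firstStep (G : MarkovGame S A) (π : JointPolicy S A) : Measure (JointStep S A) :=
  actionStep π G.init

/-- The law of the next joint state-action pair with communication, given the current one. -/
def nextStep (G : MarkovGame S A) (π : JointPolicy S A) (z : JointStep S A) :
    Measure (JointStep S A) :=
  (G.jointTrans z).bind (actionStep π)

instance (G : MarkovGame S A) (z : JointStep S A) : IsProbabilityMeasure (G.jointTrans z) := by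
  unfold jointTrans; infer_instance

instance (π : JointPolicy S A) (s : ∀ i, S i) : IsProbabilityMeasure (actionStep π s) :=
  Measure.isProbabilityMeasure_map (measurable_of_countable _).aemeasurable

instance (G : MarkovGame S A) (π : JointPolicy S A) : IsProbabilityMeasure (G.firstStep π) := by
  unfold firstStep; infer_instance

instance (G : MarkovGame S A) (π : JointPolicy S A) (z : JointStep S A) :
    IsProbabilityMeasure (G.nextStep π z) :=
  isProbabilityMeasure_bind (measurable_of_countable _).aemeasurable
    (Filter.Eventually.of_forall fun _ => inferInstance)

/-- The one-step kernel with communication, read as a kernel on histories up to time `n`. -/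
def fullKernel (G : MarkovGame S A) (π : JointPolicy S A) (n : ℕ) :
    Kernel (Finset.Iic n → JointStep S A) (JointStep S A) where
  toFun h := G.nextStep π (h ⟨n, Finset.mem_Iic.2 le_rfl⟩)
  measurable' := measurable_of_countable _

instance (G : MarkovGame S A) (π : JointPolicy S A) (n : ℕ) :
    IsMarkovKernel (G.fullKernel π n) :=
  ⟨fun h => inferInstanceAs
    (IsProbabilityMeasure (G.nextStep π (h ⟨n, Finset.mem_Iic.2 le_rfl⟩)))⟩

/-- The law of the joint path when the joint policy is executed with full communication. -/
def fullPathLaw (G : MarkovGame S A) (π : JointPolicy S A) : Measure (ℕ → JointStep S A) :=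
  Kernel.trajMeasure (X := fun _ => JointStep S A) (G.firstStep π) (G.fullKernel π)

/-! Execution with imaginary play. A configuration `b : ι → JointStep S A` records the joint
state-action pair `b i` that each agent `i` has in mind; its own component `b i i` is its actual
local state and action, the components `b i j`, `j ≠ i`, are its imaginary teammates (while
communication is available, these are the actual teammates). -/

/-- The joint state-action pair that is actually realized in a configuration. -/
def actual (b : ι → JointStep S A) : JointStep S A := fun i => b i i

open Classical in
/-- The law of the configuration at time `0`. With communication (`c`) the agents draw one joint
action and all know it; without, every agent draws its own joint action independently. -/
def configFirst (G : MarkovGame S A) (π : JointPolicy S A) (c : Prop) :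
    Measure (ι → JointStep S A) :=
  if c then (G.firstStep π).map (fun z _ => z) else Measure.pi fun _ => G.firstStep π

open Classical in
/-- The law of the next configuration. With communication (`c`) the actual local states evolve, are
shared, and one joint action is drawn, which all agents know. Without, the agents act independently
of each other: agent `i` moves from its local state `(b i i).1`, samples the next states of its
imaginary teammates from `b i j`, `j ≠ i`, and draws a joint action from the policy at the joint
state so obtained. -/
def configNext (G : MarkovGame S A) (π : JointPolicy S A) (c : Prop) (b : ι → JointStep S A) :
    Measure (ι → JointStep S A) :=
  if c then (G.nextStep π (actual b)).map (fun z _ => z) else Measure.pi fun i => G.nextStep π (b i)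

instance (G : MarkovGame S A) (π : JointPolicy S A) (c : Prop) :
    IsProbabilityMeasure (G.configFirst π c) := by
  unfold configFirst
  split_ifs
  · exact Measure.isProbabilityMeasure_map (measurable_of_countable _).aemeasurable
  · infer_instance

instance (G : MarkovGame S A) (π : JointPolicy S A) (c : Prop) (b : ι → JointStep S A) :
    IsProbabilityMeasure (G.configNext π c b) := by
  unfold configNext
  split_ifs
  · exact Measure.isProbabilityMeasure_map (measurable_of_countable _).aemeasurable
  · infer_instance

/-- The step of the algorithm from time `n` to time `n + 1`, when communication is available
exactly at the times `t < tloss`. -/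
def configKernel (G : MarkovGame S A) (π : JointPolicy S A) (tloss : ℕ∞) (n : ℕ) :
    Kernel (Finset.Iic n → (ι → JointStep S A)) (ι → JointStep S A) where
  toFun h := G.configNext π (((n + 1 : ℕ) : ℕ∞) < tloss) (h ⟨n, Finset.mem_Iic.2 le_rfl⟩)
  measurable' := measurable_of_countable _

instance (G : MarkovGame S A) (π : JointPolicy S A) (tloss : ℕ∞) (n : ℕ) :
    IsMarkovKernel (G.configKernel π tloss n) :=
  ⟨fun h => inferInstanceAs (IsProbabilityMeasure
    (G.configNext π (((n + 1 : ℕ) : ℕ∞) < tloss) (h ⟨n, Finset.mem_Iic.2 le_rfl⟩)))⟩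

/-- The law of the actual joint path under imaginary play with loss time `tloss`. -/
def imgPathLaw (G : MarkovGame S A) (π : JointPolicy S A) (tloss : ℕ∞) :
    Measure (ℕ → JointStep S A) :=
  (Kernel.trajMeasure (X := fun _ => ι → JointStep S A)
    (G.configFirst π (((0 : ℕ) : ℕ∞) < tloss)) (G.configKernel π tloss)).map
      fun ω t => actual (ω t)

end

end MarkovGame

open Classical in
/-- Shannon entropy in nats of a probability measure: `-∑ p(x) log p(x)` for a discrete one
(concentrated on a countable set), and `∞` for one that is not discrete. -/
def shannonEntropy {α : Type*} [MeasurableSpace α] (μ : Measure α) : ℝ≥0∞ :=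
  if ∃ s : Set α, s.Countable ∧ μ sᶜ = 0 then
    ∑' x, ENNReal.ofReal (Real.negMulLog (μ.real {x}))
  else ∞

section

variable {ι : Type*} [Fintype ι] {S A : ι → Type*}
  [∀ i, MeasurableSpace (S i)] [∀ i, MeasurableSpace (A i)]

/-- `∑ i, H(Xⁱ) - H(X)`, where `X` is a joint process with law `μ` over the time set `T`
and `Xⁱ` is its `i`-th component process. It is meaningful whenever `H(X)` is finite. -/
def entropyGap {T : Type*} (μ : Measure (T → JointStep S A)) : EReal :=
  ∑ i, (shannonEntropy (μ.map fun ω t => ω t i) : EReal) - (shannonEntropy μ : EReal)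

/-- Total correlation of a joint process over infinite time with law `μ`: the supremum over all
horizons `n` of `∑ i, H(Xⁱ₀ … Xⁱₙ₋₁) - H(X₀ … Xₙ₋₁)` (these values are nondecreasing in `n`). -/
def totalCorrelation (μ : Measure (ℕ → JointStep S A)) : EReal :=
  ⨆ n : ℕ, entropyGap (μ.map fun ω (t : Fin n) => ω t)

end

end

/-! Write P for the law under full communication, p for its probabilities, and fix a horizon n with
loss time T ≤ n. Before T all agents share one configuration. From T on, each agent runs its own
copy of the full-communication chain, independently of the others given the shared prefix. So
imaginary play gives a path x the probability p(x_{<T}) ∏_i p(x^i_{<n} | x_{<T}) whenever p(x_{<T})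
> 0; `imgPathLaw_pathCylinder_mul` is this formula with denominators cleared.

For T = 0 the formula is the product of the agents' marginals, so the divergence over horizon n is
the entropy gap (`entropyGap_map_pathPrefix`). For general T, the divergence for T = 0 exceeds the
one for T by the total correlation of X_{<T} plus ∑_i I(X_{<T}; X^i_{<n} | X^i_{<T}). The first term
is nonnegative by subadditivity of entropy, the others by submodularity; `sum_imgLogMass_zero_le`
carries this out.

Infinite horizons are reached through `klDiv_eq_iSup_map`: divergence is the supremum over finite
observations, by martingale convergence of densities and Fatou. If H(X) is finite, the law is
discrete and prefix entropies converge to path entropies, so the nondecreasing gaps converge to the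
gap of the whole process. -/

noncomputable section

/-! ### Divergence as a supremum over increasing observations -/

open Filter Topology in
/-- Fenchel–Young bound for a divergence: it controls the mass that `μ` gives to a set in terms of
the mass that `ν` gives to it. -/
lemma mul_measureReal_le_klDiv_add {α : Type*} [MeasurableSpace α] (μ ν : Measure α)
    [IsFiniteMeasure μ] [IsFiniteMeasure ν] (h : klDiv μ ν ≠ ∞) (B : Set α)
    (c : ℝ) :
    c * μ.real B ≤ (klDiv μ ν).toReal + (Real.exp c - 1) * ν.real B := by
  obtain ⟨hac, hint⟩ := klDiv_ne_top_iff.1 h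
  have hk : Integrable (fun x => klFun (μ.rnDeriv ν x).toReal) ν :=
    (integrable_klFun_rnDeriv_iff hac).2 hint
  have hd : Integrable (fun x => (μ.rnDeriv ν x).toReal) ν := Measure.integrable_toReal_rnDeriv
  -- Young's inequality, `exp c - 1` being the convex conjugate of `klFun` at `c`. For x > 0 it is
  -- `0 ≤ klFun (x / exp c)` multiplied by `exp c`.
  have key : ∀ x : ℝ, 0 ≤ x → c * x - (Real.exp c - 1) ≤ klFun x := by
    intro x hx
    have h0 := klFun_nonneg (div_nonneg hx (Real.exp_pos c).le)
    rcases hx.eq_or_lt with rfl | hx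
    · have := Real.exp_pos c
      simp [klFun_zero]; linarith
    rw [klFun_apply, Real.log_div hx.ne' (Real.exp_pos c).ne', Real.log_exp] at h0
    have h1 := mul_nonneg (Real.exp_pos c).le h0
    have h2 : Real.exp c * (x / Real.exp c * (Real.log x - c) + 1 - x / Real.exp c)
        = x * (Real.log x - c) + Real.exp c - x := by
      field_simp
    rw [h2] at h1
    rw [klFun_apply]; linarith
  have h1 : ∫ x in B, (c * (μ.rnDeriv ν x).toReal - (Real.exp c - 1)) ∂ν
      ≤ ∫ x in B, klFun (μ.rnDeriv ν x).toReal ∂ν :=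
    setIntegral_mono ((hd.const_mul c).sub (integrable_const _)).integrableOn hk.integrableOn
      fun x => key _ ENNReal.toReal_nonneg
  have h2 : ∫ x in B, klFun (μ.rnDeriv ν x).toReal ∂ν ≤ (klDiv μ ν).toReal := by
    rw [toReal_klDiv_eq_integral_klFun hac]
    exact setIntegral_le_integral hk
      (Eventually.of_forall fun x => klFun_nonneg ENNReal.toReal_nonneg)
  rw [integral_sub (hd.const_mul c).integrableOn (integrable_const _).integrableOn,
    integral_const_mul, Measure.setIntegral_toReal_rnDeriv hac] at h1
  simp only [integral_const, measureReal_restrict_apply_univ, smul_eq_mul] at h1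
  linarith

section

variable {Ω : Type*} [m0 : MeasurableSpace Ω] {Y : ℕ → Type*} [mY : ∀ n, MeasurableSpace (Y n)]
  {r : ∀ n, Ω → Y n}

/-- Because the observed σ-algebras increase, their union is a set algebra, and it generates the
whole σ-algebra. -/
lemma measureDense_comap (hr : ∀ n, Measurable (r n))
    (hmono : Monotone fun n => (mY n).comap (r n)) (hgen : m0 ≤ ⨆ n, (mY n).comap (r n))
    (μ : Measure Ω) [IsFiniteMeasure μ] :
    μ.MeasureDense {s | ∃ n, MeasurableSet[(mY n).comap (r n)] s} := by
  refine Measure.MeasureDense.of_generateFrom_isSetAlgebra_finite μ ⟨⟨0, ?_⟩, ?_, ?_⟩ ?_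
  · exact @MeasurableSet.empty _ ((mY 0).comap (r 0))
  · rintro s ⟨n, hs⟩
    exact ⟨n, hs.compl⟩
  · rintro s t ⟨n, hs⟩ ⟨k, ht⟩
    exact ⟨max n k, (hmono (le_max_left n k) _ hs).union (hmono (le_max_right n k) _ ht)⟩
  · refine le_antisymm (hgen.trans ?_) ?_
    · refine iSup_le fun n s hs => MeasurableSpace.measurableSet_generateFrom ⟨n, hs⟩
    · refine MeasurableSpace.generateFrom_le ?_
      rintro s ⟨n, hs⟩
      exact (hr n).comap_le _ hs

/-- Approximate a `Q`-null set `N` by an event seen at a finite stage and apply the Fenchel–Young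
bound there. The bound `K` does not depend on the stage, so `c * P N ≤ K` for every `c > 0`, which
forces `P N = 0`. -/
lemma absolutelyContinuous_of_klDiv_map_le (hr : ∀ n, Measurable (r n))
    (hmono : Monotone fun n => (mY n).comap (r n)) (hgen : m0 ≤ ⨆ n, (mY n).comap (r n))
    (P Q : Measure Ω) [IsFiniteMeasure P] [IsFiniteMeasure Q] {K : ℝ≥0∞} (hK : K ≠ ∞)
    (h : ∀ n, klDiv (P.map (r n)) (Q.map (r n)) ≤ K) : P ≪ Q := by
  refine Measure.AbsolutelyContinuous.mk fun N hN hQ => ?_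
  have bound : ∀ c : ℝ, 0 < c → c * P.real N ≤ K.toReal := by
    intro c hc
    refine le_of_forall_pos_le_add fun δ hδ => ?_
    -- The error `c * ε` comes from replacing `N` under `P`, and `exp c * ε` from the mass that `Q`
    -- gives to the approximating event.
    obtain ⟨ε, hε, hεδ⟩ : ∃ ε : ℝ, 0 < ε ∧ (c + Real.exp c) * ε ≤ δ := by
      have : 0 < c + Real.exp c := by positivity
      exact ⟨δ / (c + Real.exp c), by positivity, by field_simp; rfl⟩
    obtain ⟨E, ⟨n, B, hB, rfl⟩, hE⟩ := (measureDense_comap hr hmono hgen (P + Q)).approx N hN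
      (measure_ne_top _ _) ε hε
    have hBm := hr n hB
    rw [Measure.add_apply] at hE
    have hP : P.real N ≤ P.real (r n ⁻¹' B) + ε := by
      have h1 : P N ≤ P (r n ⁻¹' B) + ENNReal.ofReal ε := by
        refine (measure_mono (t := r n ⁻¹' B ∪ symmDiff N (r n ⁻¹' B)) ?_).trans
          ((measure_union_le _ _).trans (by gcongr; exact le_self_add.trans hE.le))
        intro x hx
        by_cases hxB : x ∈ r n ⁻¹' B
        · exact Or.inl hxB
        · exact Or.inr (Or.inl ⟨hx, hxB⟩)
      have := ENNReal.toReal_mono (by finiteness) h1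
      rwa [ENNReal.toReal_add (by finiteness) (by finiteness), ENNReal.toReal_ofReal hε.le] at this
    have hQ' : Q.real (r n ⁻¹' B) ≤ ε := by
      have h1 : Q (r n ⁻¹' B) ≤ ENNReal.ofReal ε := by
        refine (measure_mono (t := N ∪ symmDiff N (r n ⁻¹' B)) ?_).trans
          ((measure_union_le _ _).trans (by rw [hQ, zero_add]; exact le_add_self.trans hE.le))
        intro x hx
        by_cases hxN : x ∈ N
        · exact Or.inl hxN
        · exact Or.inr (Or.inr ⟨hx, hxN⟩)
      have := ENNReal.toReal_mono (by finiteness) h1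
      rwa [ENNReal.toReal_ofReal hε.le] at this
    have hfin : klDiv (P.map (r n)) (Q.map (r n)) ≠ ∞ := ne_top_of_le_ne_top hK (h n)
    have h1 := mul_measureReal_le_klDiv_add _ _ hfin B c
    rw [map_measureReal_apply (hr n) hB, map_measureReal_apply (hr n) hB] at h1
    have h2 := ENNReal.toReal_mono hK (h n)
    have h3 : c * P.real N ≤ c * (P.real (r n ⁻¹' B) + ε) := by gcongr
    have h4 : (Real.exp c - 1) * Q.real (r n ⁻¹' B) ≤ Real.exp c * ε := by
      have : 0 ≤ Q.real (r n ⁻¹' B) := measureReal_nonneg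
      have := Real.exp_pos c
      nlinarith
    linarith
  have h0 : P.real N = 0 := by
    by_contra hne
    have hpos : 0 < P.real N := lt_of_le_of_ne measureReal_nonneg (Ne.symm hne)
    have hK0 : 0 ≤ K.toReal := ENNReal.toReal_nonneg
    have := bound ((K.toReal + 1) / P.real N) (by positivity)
    rw [div_mul_cancel₀ _ hne] at this
    linarith
  exact (measureReal_eq_zero_iff (by finiteness)).1 h0

open Filter Topology in
/-- The divergence of two finite measures is the supremum of the divergences of their images
under an increasing family of observations that generates the σ-algebra. -/
theorem klDiv_eq_iSup_map (hr : ∀ n, Measurable (r n))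
    (hmono : Monotone fun n => (mY n).comap (r n)) (hgen : m0 ≤ ⨆ n, (mY n).comap (r n))
    (P Q : Measure Ω) [IsFiniteMeasure P] [IsFiniteMeasure Q] :
    klDiv P Q = ⨆ n, klDiv (P.map (r n)) (Q.map (r n)) := by
  refine le_antisymm ?_ (iSup_le fun n => klDiv_map_le P Q (hr n))
  set K := ⨆ n, klDiv (P.map (r n)) (Q.map (r n)) with hKdef
  have hle : ∀ n, klDiv (P.map (r n)) (Q.map (r n)) ≤ K := le_iSup _
  by_cases hK : K = ∞
  · rw [hK]; exact le_top
  have hac := absolutelyContinuous_of_klDiv_map_le hr hmono hgen P Q hK hle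
  let ℱ : Filtration ℕ m0 := ⟨fun n => (mY n).comap (r n), hmono, fun n => (hr n).comap_le⟩
  have hsup : ⨆ n, ℱ n = m0 := le_antisymm (iSup_le ℱ.le) hgen
  set f : Ω → ℝ := fun x => (P.rnDeriv Q x).toReal
  have hf : Integrable f Q := Measure.integrable_toReal_rnDeriv
  have hfm : StronglyMeasurable[⨆ n, ℱ n] f := by
    rw [hsup]; exact (Measure.measurable_rnDeriv P Q).ennreal_toReal.stronglyMeasurable
  have hlim := hf.tendsto_ae_condExp hfm
  -- The density of the image measures, read on `Ω`, is the conditional expectation of the density;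
  -- the integral is therefore the stage-`n` divergence.
  have hn : ∀ n, ∫⁻ x, ENNReal.ofReal (klFun ((Q[f|ℱ n]) x)) ∂Q ≤ K := by
    intro n
    refine le_trans (le_of_eq ?_) (hle n)
    have hfin : klDiv (P.map (r n)) (Q.map (r n)) ≠ ∞ := ne_top_of_le_ne_top hK (hle n)
    rw [klDiv_eq_lintegral_klFun_of_ac (hac.map (hr n)), lintegral_map (by fun_prop) (hr n)]
    refine lintegral_congr_ae ?_
    filter_upwards [toReal_rnDeriv_map hac (hr n)] with x hx
    rw [hx]
  calc klDiv P Q = ∫⁻ x, ENNReal.ofReal (klFun (f x)) ∂Q := klDiv_eq_lintegral_klFun_of_ac hac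
    _ = ∫⁻ x, liminf (fun n => ENNReal.ofReal (klFun ((Q[f|ℱ n]) x))) atTop ∂Q := by
      refine lintegral_congr_ae ?_
      filter_upwards [hlim] with x hx
      exact (((ENNReal.continuous_ofReal.comp continuous_klFun).tendsto _).comp hx).liminf_eq.symm
    -- Fatou's lemma.
    _ ≤ liminf (fun n => ∫⁻ x, ENNReal.ofReal (klFun ((Q[f|ℱ n]) x)) ∂Q) atTop := by
      refine lintegral_liminf_le' fun n => ?_
      have : AEMeasurable (Q[f|ℱ n]) Q := integrable_condExp.aestronglyMeasurable.aemeasurable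
      exact (measurable_klFun.comp_aemeasurable this).ennreal_ofReal
    _ ≤ K := by
      refine liminf_le_of_le (by isBoundedDefault) fun b hb => ?_
      obtain ⟨n, hn'⟩ := hb.exists
      exact hn'.trans (hn n)

end

/-! ### Path prefixes, cylinders and their mass under a trajectory law -/

/-- The part of a path at the times `0, …, n - 1`. -/
abbrev pathPrefix {X : Type*} (n : ℕ) (ω : ℕ → X) : Fin n → X := fun t => ω t

/-- The set of paths that agree with `x` at the times `0, …, n - 1`. -/
def pathCylinder {X : Type*} (n : ℕ) (x : ℕ → X) : Set (ℕ → X) := {ω | ∀ t < n, ω t = x t}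

lemma pathCylinder_eq_preimage {X : Type*} (n : ℕ) (x : ℕ → X) :
    pathCylinder n x = pathPrefix n ⁻¹' {pathPrefix n x} := by
  ext ω
  simp only [pathCylinder, pathPrefix, Set.mem_ofPred_eq, Set.mem_preimage, Set.mem_singleton_iff,
    funext_iff]
  exact ⟨fun h t => h t t.2, fun h t ht => h ⟨t, ht⟩⟩

lemma pathPrefix_surjective {X : Type*} [Nonempty X] (n : ℕ) :
    Function.Surjective (pathPrefix (X := X) n) := by
  intro v
  refine ⟨fun t => if h : t < n then v ⟨t, h⟩ else Classical.arbitrary X, ?_⟩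
  ext t
  simp [pathPrefix]

lemma measurable_pathPrefix {X : Type*} [MeasurableSpace X] (n : ℕ) :
    Measurable (pathPrefix (X := X) n) := by
  unfold pathPrefix; fun_prop

lemma pathCylinder_congr {X : Type*} {n : ℕ} {x y : ℕ → X} (h : ∀ t < n, x t = y t) :
    pathCylinder n x = pathCylinder n y := by
  ext ω
  exact ⟨fun hω t ht => (hω t ht).trans (h t ht), fun hω t ht => (hω t ht).trans (h t ht).symm⟩

lemma pathCylinder_anti {X : Type*} {m n : ℕ} (h : m ≤ n) (x : ℕ → X) :
    pathCylinder n x ⊆ pathCylinder m x := fun _ hω t ht => hω t (ht.trans_le h)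

lemma measurableSet_pathCylinder {X : Type*} [MeasurableSpace X] [MeasurableSingletonClass X]
    (n : ℕ) (x : ℕ → X) : MeasurableSet (pathCylinder n x) := by
  rw [pathCylinder_eq_preimage]
  exact measurable_pathPrefix n (measurableSet_singleton _)

@[simp]
lemma pathCylinder_zero {X : Type*} (x : ℕ → X) : pathCylinder 0 x = Set.univ := by
  simp [pathCylinder]

section chain

variable {X : Type*} [MeasurableSpace X] [MeasurableSingletonClass X]
  (μ₀ : Measure X)
  (κ : (n : ℕ) → Kernel (Finset.Iic n → X) X) [∀ n, IsMarkovKernel (κ n)]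

lemma trajMeasure_pathCylinder_one (x : ℕ → X) :
    Kernel.trajMeasure (X := fun _ => X) μ₀ κ (pathCylinder 1 x) = μ₀ {x 0} := by
  have h : (Kernel.trajMeasure (X := fun _ => X) μ₀ κ).map
      (Preorder.frestrictLe (π := fun _ => X) 0) =
      μ₀.map (MeasurableEquiv.piUnique (fun _ : Finset.Iic 0 => X)).symm := by
    rw [Kernel.trajMeasure, Measure.map_comp _ _ (by fun_prop), Kernel.traj_map_frestrictLe,
      Kernel.partialTraj_self, Measure.id_comp]
  have hs : pathCylinder 1 x = (Preorder.frestrictLe (π := fun _ => X) 0) ⁻¹'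
      {Preorder.frestrictLe (π := fun _ => X) 0 x} := by
    ext ω
    simp only [pathCylinder, Set.mem_ofPred_eq, Set.mem_preimage, Set.mem_singleton_iff,
      funext_iff, Preorder.frestrictLe_apply]
    refine ⟨fun h t => h t ?_, fun h t ht => h ⟨t, ?_⟩⟩
    · have := Finset.mem_Iic.1 t.2; omega
    · exact Finset.mem_Iic.2 (by omega)
  rw [hs, ← Measure.map_apply (by fun_prop) (measurableSet_singleton _), h,
    Measure.map_apply (by fun_prop) (measurableSet_singleton _)]
  congr 1
  ext y
  simp only [Set.mem_preimage, Set.mem_singleton_iff, funext_iff]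
  constructor
  · intro h; exact h ⟨0, by simp⟩
  · rintro h ⟨t, ht⟩
    obtain rfl : t = 0 := by simpa using ht
    exact h

/-- The cylinder is a rectangle for the pair (history up to time `n`, value at `n + 1`), whose law
is a composition product with `κ n`. A history up to time `n` has `n + 1` entries, hence the shifted
indices. -/
lemma trajMeasure_pathCylinder_succ [IsProbabilityMeasure μ₀] (x : ℕ → X) (n : ℕ) :
    Kernel.trajMeasure (X := fun _ => X) μ₀ κ (pathCylinder (n + 2) x) =
      Kernel.trajMeasure (X := fun _ => X) μ₀ κ (pathCylinder (n + 1) x) *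
        κ n (fun t => x t) {x (n + 1)} := by
  have h := Kernel.map_frestrictLe_trajMeasure_compProd_eq_map_trajMeasure
    (X := fun _ => X) (μ₀ := μ₀) (κ := κ) (a := n)
  have hs : pathCylinder (n + 1) x = (Preorder.frestrictLe (π := fun _ => X) n) ⁻¹'
      {Preorder.frestrictLe (π := fun _ => X) n x} := by
    ext ω
    simp only [pathCylinder, Set.mem_ofPred_eq, Set.mem_preimage, Set.mem_singleton_iff,
      funext_iff, Preorder.frestrictLe_apply]
    refine ⟨fun h t => h t ?_, fun h t ht => h ⟨t, ?_⟩⟩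
    · have := Finset.mem_Iic.1 t.2; omega
    · exact Finset.mem_Iic.2 (by omega)
  have hs2 : pathCylinder (n + 2) x =
      (fun ω : ℕ → X => (Preorder.frestrictLe (π := fun _ => X) n ω, ω (n + 1))) ⁻¹'
      ({Preorder.frestrictLe (π := fun _ => X) n x} ×ˢ {x (n + 1)}) := by
    ext ω
    simp only [Set.mem_preimage, Set.mem_prod]
    rw [← Set.mem_preimage, ← hs]
    simp only [pathCylinder, Set.mem_ofPred_eq, Set.mem_singleton_iff]
    refine ⟨fun h => ⟨fun t ht => h t (by omega), h _ (by omega)⟩, fun h t ht => ?_⟩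
    rcases Nat.lt_succ_iff_lt_or_eq.1 ht with h1 | rfl
    · exact h.1 t h1
    · exact h.2
  rw [hs2, ← Measure.map_apply (by fun_prop)
    ((measurableSet_singleton _).prod (measurableSet_singleton _)), ← h,
    Measure.compProd_apply_prod (measurableSet_singleton _) (measurableSet_singleton _),
    lintegral_singleton, hs, ← Measure.map_apply (by fun_prop) (measurableSet_singleton _),
    mul_comm]
  rfl

end chain

/-! ### Finite-dimensional distributions of imaginary play -/

namespace MarkovGame

section

variable {ι : Type*} [Fintype ι] {S A : ι → Type*}
  [∀ i, Fintype (S i)] [∀ i, MeasurableSpace (S i)] [∀ i, DiscreteMeasurableSpace (S i)]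
  [∀ i, Fintype (A i)] [∀ i, MeasurableSpace (A i)] [∀ i, DiscreteMeasurableSpace (A i)]
  (G : MarkovGame S A) (π : JointPolicy S A)

instance : IsProbabilityMeasure (G.fullPathLaw π) := by
  unfold fullPathLaw; infer_instance

/-- The law of the path of configurations under imaginary play. -/
def configPathLaw (τ : ℕ∞) : Measure (ℕ → (ι → JointStep S A)) :=
  Kernel.trajMeasure (X := fun _ => ι → JointStep S A)
    (G.configFirst π (((0 : ℕ) : ℕ∞) < τ)) (G.configKernel π τ)

instance (τ : ℕ∞) : IsProbabilityMeasure (G.configPathLaw π τ) := by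
  unfold configPathLaw; infer_instance

lemma measurable_actual_comp :
    Measurable fun (ω : ℕ → ι → JointStep S A) (t : ℕ) => actual (ω t) :=
  measurable_pi_lambda _ fun t => (measurable_of_countable actual).comp (measurable_pi_apply t)

instance (τ : ℕ∞) : IsProbabilityMeasure (G.imgPathLaw π τ) := by
  exact Measure.isProbabilityMeasure_map measurable_actual_comp.aemeasurable

lemma fullPathLaw_pathCylinder_one (x : ℕ → JointStep S A) :
    G.fullPathLaw π (pathCylinder 1 x) = G.firstStep π {x 0} :=
  trajMeasure_pathCylinder_one _ _ x

lemma fullPathLaw_pathCylinder_succ (x : ℕ → JointStep S A) (n : ℕ) :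
    G.fullPathLaw π (pathCylinder (n + 2) x) =
      G.fullPathLaw π (pathCylinder (n + 1) x) * G.nextStep π (x n) {x (n + 1)} :=
  trajMeasure_pathCylinder_succ _ _ x n

lemma configPathLaw_pathCylinder_one (τ : ℕ∞) (x : ℕ → ι → JointStep S A) :
    G.configPathLaw π τ (pathCylinder 1 x) =
      G.configFirst π (((0 : ℕ) : ℕ∞) < τ) {x 0} :=
  trajMeasure_pathCylinder_one _ _ x

lemma configPathLaw_pathCylinder_succ (τ : ℕ∞) (x : ℕ → ι → JointStep S A) (n : ℕ) :
    G.configPathLaw π τ (pathCylinder (n + 2) x) =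
      G.configPathLaw π τ (pathCylinder (n + 1) x) *
        G.configNext π (((n + 1 : ℕ) : ℕ∞) < τ) (x n) {x (n + 1)} :=
  trajMeasure_pathCylinder_succ _ _ x n

lemma map_const_singleton_const (μ : Measure (JointStep S A)) (z : JointStep S A) :
    μ.map (fun z (_ : ι) => z) {fun _ => z} = μ {z} := by
  rw [Measure.map_apply (measurable_of_countable _) (measurableSet_singleton _)]
  congr 1
  ext w
  simp only [Set.mem_preimage, Set.mem_singleton_iff]
  exact ⟨fun h => funext fun i => congrFun (congrFun h i) i, fun h => by rw [h]⟩

lemma map_const_singleton_of_ne (μ : Measure (JointStep S A)) (b : ι → JointStep S A)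
    (hb : b ≠ fun _ => actual b) : μ.map (fun z (_ : ι) => z) {b} = 0 := by
  rw [Measure.map_apply (measurable_of_countable _) (measurableSet_singleton _)]
  convert! measure_empty (μ := μ)
  ext w
  simp only [Set.mem_preimage, Set.mem_singleton_iff, Set.mem_empty_iff_false, iff_false]
  rintro rfl
  exact hb rfl

lemma configPathLaw_pathCylinder_const (τ : ℕ∞) (x : ℕ → JointStep S A) (n : ℕ)
    (hn : ∀ t < n, (t : ℕ∞) < τ) :
    G.configPathLaw π τ (pathCylinder n fun t _ => x t) =
      G.fullPathLaw π (pathCylinder n x) := by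
  induction n with
  | zero => simp
  | succ n ih =>
    rcases n with _ | n
    · rw [configPathLaw_pathCylinder_one, fullPathLaw_pathCylinder_one, configFirst,
        if_pos (hn 0 (by omega)), map_const_singleton_const]
    · rw [configPathLaw_pathCylinder_succ, fullPathLaw_pathCylinder_succ, configNext,
        if_pos (hn (n + 1) (by omega)), map_const_singleton_const,
        ih fun t ht => hn t (by omega)]
      rfl

lemma configPathLaw_pathCylinder_of_ne (τ : ℕ∞) (c : ℕ → ι → JointStep S A) (n t : ℕ)
    (htn : t < n) (ht : (t : ℕ∞) < τ) (hc : c t ≠ fun _ => actual (c t)) :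
    G.configPathLaw π τ (pathCylinder n c) = 0 := by
  refine measure_mono_null (pathCylinder_anti (Nat.succ_le_of_lt htn) c) ?_
  rcases t with _ | t
  · rw [Nat.succ_eq_add_one, zero_add, configPathLaw_pathCylinder_one, configFirst, if_pos ht,
      map_const_singleton_of_ne _ _ hc]
  · rw [Nat.succ_eq_add_one, configPathLaw_pathCylinder_succ, configNext, if_pos ht,
      map_const_singleton_of_ne _ _ hc, mul_zero]

/-- After the loss each transition is a product over agents, and the factor of agent `i` is the
full-communication step applied to its own configuration. The powers of the prefix mass clear
denominators, so that null prefixes need no separate treatment. -/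
lemma configPathLaw_pathCylinder_mul (τ : ℕ∞) (x : ℕ → JointStep S A)
    (c : ℕ → ι → JointStep S A) {T n : ℕ} (hTn : T ≤ n)
    (hT : ∀ t < n, (t : ℕ∞) < τ ↔ t < T) (hc : ∀ t < T, c t = fun _ => x t) :
    G.configPathLaw π τ (pathCylinder n c) *
        G.fullPathLaw π (pathCylinder T x) ^ Fintype.card ι =
      G.fullPathLaw π (pathCylinder T x) *
        ∏ i, G.fullPathLaw π (pathCylinder n fun t => c t i) := by
  induction n, hTn using Nat.le_induction with
  | base =>
    rw [pathCylinder_congr hc, configPathLaw_pathCylinder_const _ _ _ _ _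
      fun t ht => (hT t ht).2 ht]
    congr 1
    rw [Finset.prod_congr rfl fun i _ => by
      rw [pathCylinder_congr (fun t ht => congrFun (hc t ht) i)]]
    simp
  | succ n hTn ih =>
    have hflag : ¬ ((n : ℕ) : ℕ∞) < τ := by rw [hT n (by omega)]; omega
    have ih := ih fun t ht => hT t (by omega)
    rcases n with _ | n
    · obtain rfl : T = 0 := by omega
      simp_rw [zero_add, pathCylinder_zero, measure_univ, one_pow, mul_one, one_mul,
        configPathLaw_pathCylinder_one, fullPathLaw_pathCylinder_one, configFirst, if_neg hflag,
        Measure.pi_singleton]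
    · simp_rw [configPathLaw_pathCylinder_succ, fullPathLaw_pathCylinder_succ, configNext,
        if_neg hflag, Measure.pi_singleton, Finset.prod_mul_distrib]
      rw [mul_right_comm, ih, mul_assoc]

/-- The finite-dimensional distributions of imaginary play: up to the loss time the agents follow
the joint law, and afterwards each follows its own marginal of the joint law given the joint path
up to the loss time. -/
lemma imgPathLaw_pathCylinder_mul [Nonempty (JointStep S A)] (τ : ℕ∞) (x : ℕ → JointStep S A)
    {T n : ℕ} (hTn : T ≤ n) (hT : ∀ t < n, (t : ℕ∞) < τ ↔ t < T) :
    G.imgPathLaw π τ (pathCylinder n x) *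
        G.fullPathLaw π (pathCylinder T x) ^ Fintype.card ι =
      G.fullPathLaw π (pathCylinder T x) *
        ∏ i, G.fullPathLaw π {ω | (∀ t < T, ω t = x t) ∧ ∀ t < n, ω t i = x t i} := by
  set p := G.fullPathLaw π (pathCylinder T x) with hp
  set ν := (G.fullPathLaw π).map (pathPrefix n) with hν
  have : IsProbabilityMeasure ν :=
    Measure.isProbabilityMeasure_map (measurable_pathPrefix n).aemeasurable
  set μ := (G.configPathLaw π τ).map (pathPrefix n) with hμ
  -- `B` holds the configuration paths that realize `x`; `D i` holds the private paths of agent `i`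
  -- that equal `x` before `T` and have the right own component throughout. Summing over private
  -- paths turns joint masses into the agents' marginals.
  let B : Set (Fin n → ι → JointStep S A) := {c | ∀ t, actual (c t) = x t}
  let D : ι → Set (Fin n → JointStep S A) :=
    fun i => {y | (∀ t, t.1 < T → y t = x t) ∧ ∀ t, y t i = x t i}
  let sw : (ι → Fin n → JointStep S A) ≃ (Fin n → ι → JointStep S A) :=
    Equiv.piComm fun _ _ => JointStep S A
  have h1 : G.imgPathLaw π τ (pathCylinder n x) = μ B := by
    rw [imgPathLaw, Measure.map_apply measurable_actual_comp
      (measurableSet_pathCylinder _ _), hμ,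
      Measure.map_apply (measurable_pathPrefix n) (Set.to_countable _).measurableSet]
    congr 1
    ext ω
    exact ⟨fun h t => h t t.2, fun h t ht => h ⟨t, ht⟩⟩
  have h2 : ∀ i, G.fullPathLaw π {ω | (∀ t < T, ω t = x t) ∧ ∀ t < n, ω t i = x t i} =
      ν (D i) := by
    intro i
    rw [hν, Measure.map_apply (measurable_pathPrefix n) (Set.to_countable _).measurableSet]
    congr 1
    ext ω
    exact ⟨fun h => ⟨fun t ht => h.1 t ht, fun t => h.2 t t.2⟩,
      fun h => ⟨fun t ht => h.1 ⟨t, by omega⟩ ht, fun t ht => h.2 ⟨t, ht⟩⟩⟩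
  have h3 : ∏ i, ν (D i) = ∑' c, (Set.univ.pi D).indicator (fun c => ∏ i, ν {c i}) c := by
    rw [← Measure.pi_pi, ← Measure.tsum_indicator_apply_singleton _ _
      (Set.to_countable _).measurableSet]
    simp_rw [Measure.pi_singleton]
  rw [h1, ← Measure.tsum_indicator_apply_singleton _ _ (Set.to_countable _).measurableSet]
  simp_rw [h2]
  rw [h3, ← ENNReal.tsum_mul_right, ← ENNReal.tsum_mul_left, ← sw.tsum_eq]
  refine tsum_congr fun y => ?_
  -- Extends the finite array to an infinite path, so that the cylinder formulas apply.
  obtain ⟨c, hc⟩ := pathPrefix_surjective n (sw y)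
  have hcy : ∀ (t : Fin n) i, c t i = y i t := fun t i => congrFun (congrFun hc t) i
  have hμc : μ {sw y} = G.configPathLaw π τ (pathCylinder n c) := by
    rw [hμ, Measure.map_apply (measurable_pathPrefix n) (measurableSet_singleton _),
      pathCylinder_eq_preimage, hc]
  have hνc : ∀ i, ν {y i} = G.fullPathLaw π (pathCylinder n fun t => c t i) := by
    intro i
    rw [hν, Measure.map_apply (measurable_pathPrefix n) (measurableSet_singleton _),
      pathCylinder_eq_preimage]
    congr 3
    ext t : 1
    exact (hcy t i).symm
  by_cases hy : y ∈ Set.univ.pi D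
  · have hB : sw y ∈ B := fun t => funext fun i => (hy i trivial).2 t
    rw [Set.indicator_of_mem hy, Set.indicator_of_mem hB, hμc, hp,
      configPathLaw_pathCylinder_mul G π τ x c hTn hT]
    · simp_rw [hνc]
    · intro t ht
      funext i
      rw [hcy ⟨t, by omega⟩ i]
      exact (hy i trivial).1 ⟨t, by omega⟩ ht
  · rw [Set.indicator_of_notMem hy, mul_zero]
    by_cases hB : sw y ∈ B
    · rw [Set.indicator_of_mem hB, hμc]
      -- A configuration path that realizes `x` but leaves the product of the `D i` has agents
      -- disagreeing before the loss, so it has mass zero.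
      suffices h : ∃ t < T, c t ≠ fun _ => actual (c t) by
        obtain ⟨t, ht, hne⟩ := h
        rw [configPathLaw_pathCylinder_of_ne G π τ c n t (by omega)
          ((hT t (by omega)).2 ht) hne, zero_mul]
      by_contra! hcon
      refine hy fun i _ => ⟨fun t ht => ?_, fun t => congrFun (hB t) i⟩
      have h4 := congrFun (hcon t ht) i
      rw [hcy] at h4
      rw [h4]
      exact (congrArg actual (congrFun hc t)).trans (hB t)
    · rw [Set.indicator_of_notMem hB, zero_mul]

end

end MarkovGame

/-! ### Entropy inequalities for finite mass functions -/

section mass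

variable {Ω : Type*} [Fintype Ω] {α β γ : Type*} (p : Ω → ℝ)

open Classical in
/-- The mass function of the image under `F` of the distribution on `Ω` with mass function `p`. -/
def imageMass (F : Ω → α) (v : α) : ℝ := ∑ ω, if F ω = v then p ω else 0

variable {p}

lemma imageMass_nonneg (hp : ∀ ω, 0 ≤ p ω) (F : Ω → α) (v : α) : 0 ≤ imageMass p F v :=
  Finset.sum_nonneg fun ω _ => by split_ifs; exacts [hp ω, le_rfl]

lemma le_imageMass (hp : ∀ ω, 0 ≤ p ω) (F : Ω → α) (ω : Ω) : p ω ≤ imageMass p F (F ω) := by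
  classical
  have := Finset.single_le_sum (f := fun ω' => if F ω' = F ω then p ω' else 0)
    (fun ω' _ => by split_ifs; exacts [hp ω', le_rfl]) (Finset.mem_univ ω)
  simpa [imageMass] using this

lemma imageMass_congr {F : Ω → α} {F' : Ω → β} {ω : Ω} (h : ∀ ω', F ω' = F ω ↔ F' ω' = F' ω) :
    imageMass p F (F ω) = imageMass p F' (F' ω) := by
  classical
  exact Finset.sum_congr rfl fun ω' _ => if_congr (h ω') rfl rfl

lemma imageMass_id (ω : Ω) : imageMass p id ω = p ω := by
  rw [imageMass, Finset.sum_eq_single ω]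
  · exact if_pos rfl
  · exact fun ω' _ h => if_neg h
  · exact fun h => absurd (Finset.mem_univ ω) h

lemma sum_mul_comp_eq_sum_imageMass_mul [Fintype α] (F : Ω → α) (φ : α → ℝ) :
    ∑ ω, p ω * φ (F ω) = ∑ v, imageMass p F v * φ v := by
  classical
  simp_rw [imageMass, Finset.sum_mul, ite_mul, zero_mul]
  rw [Finset.sum_comm]
  simp

lemma sum_imageMass [Fintype α] (F : Ω → α) : ∑ v, imageMass p F v = ∑ ω, p ω := by
  simpa using (sum_mul_comp_eq_sum_imageMass_mul (p := p) F fun _ => 1).symm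

lemma sum_imageMass_prodMk [Fintype α] (F : Ω → α) (F' : Ω → β) (w : β) :
    ∑ v, imageMass p (fun ω => (F ω, F' ω)) (v, w) = imageMass p F' w := by
  classical
  simp_rw [imageMass]
  rw [Finset.sum_comm]
  refine Finset.sum_congr rfl fun ω _ => ?_
  by_cases h : F' ω = w <;> simp [h]

/-- Grouping by values of `F` cancels the image mass; values of mass zero drop out on the left,
which is why only an inequality holds. -/
lemma sum_mul_div_imageMass_le [Fintype α] (hp : ∀ ω, 0 ≤ p ω) (F : Ω → α) {g : α → ℝ}
    (hg : ∀ v, 0 ≤ g v) :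
    ∑ ω, p ω * (g (F ω) / imageMass p F (F ω)) ≤ ∑ v, g v := by
  rw [sum_mul_comp_eq_sum_imageMass_mul F fun v => g v / imageMass p F v]
  refine Finset.sum_le_sum fun v _ => ?_
  rcases (imageMass_nonneg hp F v).eq_or_lt with h | h
  · rw [← h]; simpa using hg v
  · rw [mul_div_cancel₀ _ h.ne']

/-- Gibbs' inequality, from `log u ≤ u - 1`. Both entropy inequalities below are instances. -/
lemma sum_mul_log_nonpos (hp : ∀ ω, 0 ≤ p ω) (hp1 : ∑ ω, p ω = 1) {u : Ω → ℝ}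
    (hu : ∀ ω, 0 < p ω → 0 < u ω) (hu1 : ∑ ω, p ω * u ω ≤ 1) :
    ∑ ω, p ω * Real.log (u ω) ≤ 0 := by
  have h : ∑ ω, p ω * Real.log (u ω) ≤ ∑ ω, p ω * (u ω - 1) := by
    refine Finset.sum_le_sum fun ω _ => ?_
    rcases (hp ω).eq_or_lt with h | h
    · simp [← h]
    · exact mul_le_mul_of_nonneg_left (Real.log_le_sub_one_of_pos (hu ω h)) h.le
  refine h.trans ?_
  simp_rw [mul_sub, mul_one, Finset.sum_sub_distrib]
  linarith

/-- Subadditivity of entropy. -/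
lemma sum_mul_log_imageMass_pi_nonneg {ι : Type*} [Fintype ι] {β : ι → Type*}
    [∀ i, Fintype (β i)] (hp : ∀ ω, 0 ≤ p ω) (hp1 : ∑ ω, p ω = 1) (F : ∀ i, Ω → β i) :
    0 ≤ ∑ ω, p ω * (Real.log (imageMass p (fun ω i => F i ω) fun i => F i ω) -
      ∑ i, Real.log (imageMass p (F i) (F i ω))) := by
  classical
  -- The likelihood ratio of the product of the marginals to the joint law.
  have h := sum_mul_log_nonpos hp hp1 (u := fun ω => (∏ i, imageMass p (F i) (F i ω)) /
      imageMass p (fun ω i => F i ω) fun i => F i ω)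
    (fun ω hω => div_pos (Finset.prod_pos fun i _ => hω.trans_le (le_imageMass hp _ _))
      (hω.trans_le (le_imageMass hp _ _))) ?_
  · rw [← neg_nonpos, ← Finset.sum_neg_distrib]
    refine le_of_eq_of_le (Finset.sum_congr rfl fun ω _ => ?_) h
    rcases (hp ω).eq_or_lt with h0 | h0
    · simp [← h0]
    · have h1 : ∀ i, imageMass p (F i) (F i ω) ≠ 0 :=
        fun i => (h0.trans_le (le_imageMass hp _ _)).ne'
      have h2 : imageMass p (fun ω i => F i ω) (fun i => F i ω) ≠ 0 :=
        (h0.trans_le (le_imageMass hp (fun ω i => F i ω) _)).ne'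
      rw [Real.log_div (Finset.prod_ne_zero_iff.2 fun i _ => h1 i) h2,
        Real.log_prod fun i _ => h1 i]
      ring
  · refine (sum_mul_div_imageMass_le hp (fun ω i => F i ω)
      (g := fun v => ∏ i, imageMass p (F i) (v i))
      fun v => Finset.prod_nonneg fun i _ => imageMass_nonneg hp _ _).trans ?_
    have := Finset.prod_univ_sum (fun i => (Finset.univ : Finset (β i)))
      (fun i v => imageMass p (F i) v)
    rw [Fintype.piFinset_univ] at this
    rw [← this]
    simp [sum_imageMass, hp1]

/-- Submodularity of entropy. -/
lemma sum_mul_log_imageMass_submodular [Fintype α] [Fintype β] [Fintype γ]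
    (hp : ∀ ω, 0 ≤ p ω) (hp1 : ∑ ω, p ω = 1) (f : Ω → α) (g : Ω → β) (h : Ω → γ) :
    0 ≤ ∑ ω, p ω * (Real.log (imageMass p (fun ω => (f ω, g ω, h ω)) (f ω, g ω, h ω)) +
      Real.log (imageMass p h (h ω)) -
      Real.log (imageMass p (fun ω => (f ω, h ω)) (f ω, h ω)) -
      Real.log (imageMass p (fun ω => (g ω, h ω)) (g ω, h ω))) := by
  -- The law under which `f` and `g` are conditionally independent given `h`, with the pair
  -- marginals `(f, h)` and `(g, h)` kept.
  let w : α × β × γ → ℝ := fun v =>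
    imageMass p (fun ω => (f ω, h ω)) (v.1, v.2.2) *
      imageMass p (fun ω => (g ω, h ω)) (v.2.1, v.2.2) / imageMass p h v.2.2
  have hw : ∀ v, 0 ≤ w v := fun v => div_nonneg
    (mul_nonneg (imageMass_nonneg hp _ _) (imageMass_nonneg hp _ _)) (imageMass_nonneg hp _ _)
  have key := sum_mul_log_nonpos hp hp1
    (u := fun ω => w (f ω, g ω, h ω) /
      imageMass p (fun ω => (f ω, g ω, h ω)) (f ω, g ω, h ω))
    (fun ω hω => div_pos (div_pos (mul_pos
        (hω.trans_le (le_imageMass hp (fun ω => (f ω, h ω)) ω))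
        (hω.trans_le (le_imageMass hp (fun ω => (g ω, h ω)) ω)))
        (hω.trans_le (le_imageMass hp h ω)))
      (hω.trans_le (le_imageMass hp (fun ω => (f ω, g ω, h ω)) ω))) ?_
  · rw [← neg_nonpos, ← Finset.sum_neg_distrib]
    refine le_of_eq_of_le (Finset.sum_congr rfl fun ω _ => ?_) key
    rcases (hp ω).eq_or_lt with h0 | h0
    · simp [← h0]
    · have h1 := (h0.trans_le (le_imageMass hp (fun ω => (f ω, h ω)) ω)).ne'
      have h2 := (h0.trans_le (le_imageMass hp (fun ω => (g ω, h ω)) ω)).ne'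
      have h3 := (h0.trans_le (le_imageMass hp h ω)).ne'
      have h4 := (h0.trans_le (le_imageMass hp (fun ω => (f ω, g ω, h ω)) ω)).ne'
      simp only [w]
      rw [Real.log_div (div_ne_zero (mul_ne_zero h1 h2) h3) h4,
        Real.log_div (mul_ne_zero h1 h2) h3, Real.log_mul h1 h2]
      ring
  · refine (sum_mul_div_imageMass_le hp (fun ω => (f ω, g ω, h ω)) hw).trans (le_of_eq ?_)
    have hc : ∀ c, ∑ a, ∑ b, w (a, b, c) = imageMass p h c := by
      intro c
      simp only [w]
      simp_rw [← Finset.sum_div, ← Finset.mul_sum, ← Finset.sum_mul, sum_imageMass_prodMk]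
      rcases eq_or_ne (imageMass p h c) 0 with h0 | h0
      · simp [h0]
      · rw [mul_div_cancel_right₀ _ h0]
    calc ∑ v, w v = ∑ a, ∑ b, ∑ c, w (a, b, c) := by
          rw [Fintype.sum_prod_type]
          exact Finset.sum_congr rfl fun a _ => Fintype.sum_prod_type _
      _ = ∑ a, ∑ c, ∑ b, w (a, b, c) :=
          Finset.sum_congr rfl fun a _ => Finset.sum_comm
      _ = ∑ c, ∑ a, ∑ b, w (a, b, c) := Finset.sum_comm
      _ = 1 := by simp_rw [hc, sum_imageMass, hp1]

end mass

/-! ### Divergence and entropy on finite types -/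

section finite

lemma shannonEntropy_of_fintype {Ω : Type*} [Fintype Ω] [MeasurableSpace Ω]
    (ν : Measure Ω) [IsProbabilityMeasure ν] :
    shannonEntropy ν = ENNReal.ofReal (∑ ω, Real.negMulLog (ν.real {ω})) := by
  rw [shannonEntropy, if_pos ⟨Set.univ, Set.countable_univ, by simp⟩, tsum_fintype,
    ENNReal.ofReal_sum_of_nonneg]
  exact fun ω _ => Real.negMulLog_nonneg measureReal_nonneg measureReal_le_one

variable {Ω : Type*} [Fintype Ω] [MeasurableSpace Ω] [MeasurableSingletonClass Ω]

lemma measureReal_preimage_singleton_eq_imageMass {α : Type*} (ν : Measure Ω) [IsFiniteMeasure ν]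
    (F : Ω → α) (v : α) : ν.real (F ⁻¹' {v}) = imageMass (fun ω => ν.real {ω}) F v := by
  classical
  rw [imageMass, ← Finset.sum_filter, sum_measureReal_singleton]
  congr 1
  ext ω
  simp

lemma sum_measureReal_singleton_univ (ν : Measure Ω) [IsProbabilityMeasure ν] :
    ∑ ω, ν.real {ω} = 1 := by
  rw [sum_measureReal_singleton]
  simp

lemma klDiv_ne_top_of_fintype {ν ρ : Measure Ω} [IsProbabilityMeasure ν] [IsProbabilityMeasure ρ]
    (h : ∀ ω, 0 < ν.real {ω} → 0 < ρ.real {ω}) :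
    klDiv ν ρ ≠ ∞ ∧
      (klDiv ν ρ).toReal =
        ∑ ω, ν.real {ω} * (Real.log (ν.real {ω}) - Real.log (ρ.real {ω})) := by
  have h0 : ∀ ω, ρ {ω} = 0 → ν {ω} = 0 := by
    intro ω hω
    by_contra hne
    have := h ω (ENNReal.toReal_pos hne (by finiteness))
    simp [measureReal_def, hω] at this
  have hac : ν ≪ ρ := by
    refine Measure.AbsolutelyContinuous.mk fun s _ hs => ?_
    rw [← Set.biUnion_of_singleton s, measure_biUnion_null_iff s.to_countable]
    exact fun ω hω => h0 ω (measure_mono_null (by simpa using hω) hs)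
  refine ⟨klDiv_ne_top hac .of_finite, ?_⟩
  rw [toReal_klDiv_of_measure_eq hac (by simp), integral_fintype .of_finite]
  refine Finset.sum_congr rfl fun ω _ => ?_
  rcases (measureReal_nonneg (μ := ν) (s := {ω})).eq_or_lt with h1 | h1
  · simp [← h1]
  · have h2 := Measure.setLIntegral_rnDeriv hac {ω}
    rw [lintegral_singleton] at h2
    have h3 : (ν.rnDeriv ρ ω).toReal * ρ.real {ω} = ν.real {ω} := by
      rw [measureReal_def, measureReal_def, ← ENNReal.toReal_mul, h2]
    rw [smul_eq_mul, llr, ← Real.log_div h1.ne' (h ω h1).ne', ← h3,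
      mul_div_cancel_right₀ _ (h ω h1).ne']

lemma shannonEntropy_map_of_fintype {α : Type*} [Fintype α] [MeasurableSpace α]
    [MeasurableSingletonClass α] (ν : Measure Ω) [IsProbabilityMeasure ν] (F : Ω → α) :
    ((shannonEntropy (ν.map F) : ℝ≥0∞) : EReal) =
      ((-∑ ω, ν.real {ω} * Real.log (imageMass (fun ω => ν.real {ω}) F (F ω)) : ℝ) : EReal) := by
  have hF : Measurable F := measurable_of_countable F
  have : IsProbabilityMeasure (ν.map F) := Measure.isProbabilityMeasure_map hF.aemeasurable
  have h : ∑ v, Real.negMulLog ((ν.map F).real {v}) =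
      -∑ ω, ν.real {ω} * Real.log (imageMass (fun ω => ν.real {ω}) F (F ω)) := by
    rw [sum_mul_comp_eq_sum_imageMass_mul F
      fun v => Real.log (imageMass (fun ω => ν.real {ω}) F v), ← Finset.sum_neg_distrib]
    refine Finset.sum_congr rfl fun v _ => ?_
    rw [map_measureReal_apply hF (measurableSet_singleton _),
      measureReal_preimage_singleton_eq_imageMass, Real.negMulLog, neg_mul]
  rw [shannonEntropy_of_fintype, h, EReal.coe_ennreal_ofReal, max_eq_left]
  rw [← h]
  exact Finset.sum_nonneg fun v _ => Real.negMulLog_nonneg measureReal_nonneg measureReal_le_one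

end finite

lemma EReal.coe_sum_real {ι : Type*} (s : Finset ι) (f : ι → ℝ) :
    ((∑ i ∈ s, f i : ℝ) : EReal) = ∑ i ∈ s, (f i : EReal) := by
  classical
  induction s using Finset.induction_on with
  | empty => simp
  | insert i s hi ih => rw [Finset.sum_insert hi, Finset.sum_insert hi, EReal.coe_add, ih]

/-! ### Reduction of path laws to finite horizons -/

lemma exists_le_forall_lt_iff (n : ℕ) (τ : ℕ∞) :
    ∃ T ≤ n, ∀ t < n, (t : ℕ∞) < τ ↔ t < T := by
  induction τ using ENat.recTopCoe with
  | top => exact ⟨n, le_rfl, fun t ht => by simp [ht]⟩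
  | coe k => exact ⟨min n k, min_le_left _ _, fun t ht => by simp [ht]⟩

lemma monotone_comap_pathPrefix {X : Type*} [MeasurableSpace X] :
    Monotone fun n => (MeasurableSpace.pi : MeasurableSpace (Fin n → X)).comap (pathPrefix n) := by
  intro m n hmn
  have h : pathPrefix (X := X) m = (fun v t => v (Fin.castLE hmn t)) ∘ pathPrefix n := rfl
  simp only
  rw [h, ← MeasurableSpace.comap_comp]
  exact MeasurableSpace.comap_mono (Measurable.comap_le (by fun_prop))

lemma pi_le_iSup_comap_pathPrefix {X : Type*} [MeasurableSpace X] :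
    (MeasurableSpace.pi : MeasurableSpace (ℕ → X)) ≤
      ⨆ n, (MeasurableSpace.pi : MeasurableSpace (Fin n → X)).comap (pathPrefix n) := by
  refine iSup_le fun t => le_trans ?_ (le_iSup _ (t + 1))
  have h : (fun ω : ℕ → X => ω t) = (fun v => v (Fin.last t)) ∘ pathPrefix (t + 1) := rfl
  rw [h, ← MeasurableSpace.comap_comp]
  exact MeasurableSpace.comap_mono (Measurable.comap_le (by fun_prop))

/-- The divergence of two laws on a path space is the supremum over all finite horizons. -/
lemma klDiv_eq_iSup_pathPrefix {X : Type*} [MeasurableSpace X] (P Q : Measure (ℕ → X))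
    [IsFiniteMeasure P] [IsFiniteMeasure Q] :
    klDiv P Q = ⨆ n, klDiv (P.map (pathPrefix n)) (Q.map (pathPrefix n)) :=
  klDiv_eq_iSup_map measurable_pathPrefix monotone_comap_pathPrefix pi_le_iSup_comap_pathPrefix P Q

lemma monotone_klDiv_pathPrefix {X : Type*} [MeasurableSpace X] (P Q : Measure (ℕ → X))
    [IsFiniteMeasure P] [IsFiniteMeasure Q] :
    Monotone fun n => klDiv (P.map (pathPrefix n)) (Q.map (pathPrefix n)) := by
  intro m n hmn
  have h : pathPrefix (X := X) m = (fun v t => v (Fin.castLE hmn t)) ∘ pathPrefix n := rfl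
  have hm : Measurable fun (v : Fin n → X) t => v (Fin.castLE hmn t) := by fun_prop
  simp only
  rw [h, ← Measure.map_map hm (measurable_pathPrefix n),
    ← Measure.map_map hm (measurable_pathPrefix n)]
  exact klDiv_map_le _ _ hm

/-! ### Comparison of loss times over a finite horizon -/

namespace MarkovGame

section

variable {ι : Type*} [Fintype ι] {S A : ι → Type*}
  [∀ i, Fintype (S i)] [∀ i, MeasurableSpace (S i)] [∀ i, DiscreteMeasurableSpace (S i)]
  [∀ i, Fintype (A i)] [∀ i, MeasurableSpace (A i)] [∀ i, DiscreteMeasurableSpace (A i)]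
  (G : MarkovGame S A) (π : JointPolicy S A)

instance (n : ℕ) : IsProbabilityMeasure ((G.fullPathLaw π).map (pathPrefix n)) :=
  Measure.isProbabilityMeasure_map (measurable_pathPrefix n).aemeasurable

instance (τ : ℕ∞) (n : ℕ) : IsProbabilityMeasure ((G.imgPathLaw π τ).map (pathPrefix n)) :=
  Measure.isProbabilityMeasure_map (measurable_pathPrefix n).aemeasurable

/-- The mass function of the joint path at the times `0, …, n - 1` with full communication. -/
def prefixMass (n : ℕ) (v : Fin n → JointStep S A) : ℝ :=
  ((G.fullPathLaw π).map (pathPrefix n)).real {v}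

/-- The part of a finite joint path up to an earlier horizon. -/
def shorten {X : Type*} {T n : ℕ} (h : T ≤ n) (v : Fin n → X) : Fin T → X :=
  fun t => v (Fin.castLE h t)

/-- The path of agent `i` in a finite joint path. -/
def agentPath {n : ℕ} (i : ι) (v : Fin n → JointStep S A) : Fin n → S i × A i := fun t => v t i

lemma prefixMass_nonneg (n : ℕ) (v : Fin n → JointStep S A) : 0 ≤ G.prefixMass π n v :=
  measureReal_nonneg

variable [Fintype (JointStep S A)]

lemma sum_prefixMass (n : ℕ) : ∑ v, G.prefixMass π n v = 1 :=
  sum_measureReal_singleton_univ _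

/-- The log-likelihood of a finite path under imaginary play with loss time `T`. -/
def imgLogMass {T n : ℕ} (h : T ≤ n) (v : Fin n → JointStep S A) : ℝ :=
  Real.log (imageMass (G.prefixMass π n) (shorten h) (shorten h v)) +
    ∑ i, (Real.log (imageMass (G.prefixMass π n) (fun v => (shorten h v, agentPath i v))
        (shorten h v, agentPath i v)) -
      Real.log (imageMass (G.prefixMass π n) (shorten h) (shorten h v)))

lemma imageMass_prefixMass_apply {α : Type*} (n : ℕ) (F : (Fin n → JointStep S A) → α)
    (x : ℕ → JointStep S A) :
    imageMass (G.prefixMass π n) F (F (pathPrefix n x)) =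
      (G.fullPathLaw π).real {ω | F (pathPrefix n ω) = F (pathPrefix n x)} := by
  unfold prefixMass
  rw [← measureReal_preimage_singleton_eq_imageMass,
    map_measureReal_apply (measurable_pathPrefix n) (Set.to_countable _).measurableSet]
  rfl

/-- A path of positive mass has positive mass in every image, so logarithms of the
cleared-denominator formula may be taken. The positivity conclusion also makes the finite-horizon
divergence finite. -/
lemma log_imgPathLaw_eq {T n : ℕ} (h : T ≤ n) (τ : ℕ∞) (hT : ∀ t < n, (t : ℕ∞) < τ ↔ t < T)
    (v : Fin n → JointStep S A) (hv : 0 < G.prefixMass π n v) :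
    0 < ((G.imgPathLaw π τ).map (pathPrefix n)).real {v} ∧
      Real.log (((G.imgPathLaw π τ).map (pathPrefix n)).real {v}) = G.imgLogMass π h v := by
  have : Nonempty (JointStep S A) :=
    (nonempty_of_isProbabilityMeasure (G.fullPathLaw π)).map fun ω => ω 0
  obtain ⟨x, rfl⟩ := pathPrefix_surjective n v
  have hp := G.prefixMass_nonneg π n
  have hr : ((G.imgPathLaw π τ).map (pathPrefix n)).real {pathPrefix n x} =
      (G.imgPathLaw π τ).real (pathCylinder n x) := by
    rw [map_measureReal_apply (measurable_pathPrefix n) (measurableSet_singleton _),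
      pathCylinder_eq_preimage]
  have ha : imageMass (G.prefixMass π n) (shorten h) (shorten h (pathPrefix n x)) =
      (G.fullPathLaw π).real (pathCylinder T x) := by
    rw [imageMass_prefixMass_apply, pathCylinder_eq_preimage]
    rfl
  have hm : ∀ i, imageMass (G.prefixMass π n) (fun v => (shorten h v, agentPath i v))
      (shorten h (pathPrefix n x), agentPath i (pathPrefix n x)) =
      (G.fullPathLaw π).real {ω | (∀ t < T, ω t = x t) ∧ ∀ t < n, ω t i = x t i} := by
    intro i
    rw [imageMass_prefixMass_apply G π n (fun v => (shorten h v, agentPath i v)) x]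
    congr 1
    ext ω
    simp only [Set.mem_ofPred_eq, Prod.mk.injEq]
    exact ⟨fun h' => ⟨fun t ht => congrFun h'.1 ⟨t, ht⟩, fun t ht => congrFun h'.2 ⟨t, ht⟩⟩,
      fun h' => ⟨funext fun t => h'.1 t t.2, funext fun t => h'.2 t t.2⟩⟩
  have ha0 : 0 < (G.fullPathLaw π).real (pathCylinder T x) := by
    rw [← ha]; exact hv.trans_le (le_imageMass hp _ _)
  have hm0 : ∀ i, 0 <
      (G.fullPathLaw π).real {ω | (∀ t < T, ω t = x t) ∧ ∀ t < n, ω t i = x t i} := by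
    intro i
    rw [← hm i]
    exact hv.trans_le (le_imageMass hp (fun v => (shorten h v, agentPath i v)) _)
  have key := congrArg ENNReal.toReal (imgPathLaw_pathCylinder_mul G π τ x h hT)
  rw [ENNReal.toReal_mul, ENNReal.toReal_mul, ENNReal.toReal_pow, ENNReal.toReal_prod] at key
  simp only [← measureReal_def] at key
  have hprod : 0 < ∏ i,
      (G.fullPathLaw π).real {ω | (∀ t < T, ω t = x t) ∧ ∀ t < n, ω t i = x t i} :=
    Finset.prod_pos fun i _ => hm0 i
  have hr0 : 0 < (G.imgPathLaw π τ).real (pathCylinder n x) := by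
    refine lt_of_le_of_ne measureReal_nonneg fun h0 => ?_
    rw [← h0, zero_mul] at key
    exact (mul_pos ha0 hprod).ne key
  refine ⟨hr ▸ hr0, ?_⟩
  have hlog := congrArg Real.log key
  rw [Real.log_mul hr0.ne' (pow_pos ha0 _).ne', Real.log_mul ha0.ne' hprod.ne', Real.log_pow,
    Real.log_prod fun i _ => (hm0 i).ne'] at hlog
  rw [hr, imgLogMass, ha]
  simp_rw [hm]
  rw [Finset.sum_sub_distrib, Finset.sum_const, Finset.card_univ, nsmul_eq_mul]
  linarith

lemma klDiv_map_pathPrefix {T n : ℕ} (h : T ≤ n) (τ : ℕ∞)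
    (hT : ∀ t < n, (t : ℕ∞) < τ ↔ t < T) :
    klDiv ((G.fullPathLaw π).map (pathPrefix n)) ((G.imgPathLaw π τ).map (pathPrefix n)) ≠ ∞ ∧
    (klDiv ((G.fullPathLaw π).map (pathPrefix n))
      ((G.imgPathLaw π τ).map (pathPrefix n))).toReal =
      ∑ v, G.prefixMass π n v * (Real.log (G.prefixMass π n v) - G.imgLogMass π h v) := by
  obtain ⟨h1, h2⟩ := klDiv_ne_top_of_fintype (ν := (G.fullPathLaw π).map (pathPrefix n))
    (ρ := (G.imgPathLaw π τ).map (pathPrefix n))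
    fun v hv => (G.log_imgPathLaw_eq π h τ hT v hv).1
  refine ⟨h1, h2.trans (Finset.sum_congr rfl fun v _ => ?_)⟩
  rcases (G.prefixMass_nonneg π n v).eq_or_lt with h0 | h0
  · rw [← h0, zero_mul]
    unfold prefixMass at h0
    rw [← h0, zero_mul]
  · rw [(G.log_imgPathLaw_eq π h τ hT v h0).2]
    rfl

lemma imgLogMass_zero {n : ℕ} (v : Fin n → JointStep S A) :
    G.imgLogMass π (Nat.zero_le n) v =
      ∑ i, Real.log (imageMass (G.prefixMass π n) (agentPath i) (agentPath i v)) := by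
  have h1 : imageMass (G.prefixMass π n) (shorten (Nat.zero_le n)) (shorten (Nat.zero_le n) v) =
      1 := by
    rw [imageMass_congr (F' := fun _ => ()) fun _ => iff_of_true (Subsingleton.elim _ _) rfl]
    simp [imageMass, sum_prefixMass]
  rw [imgLogMass, h1, Real.log_one, zero_add]
  refine Finset.sum_congr rfl fun i _ => ?_
  rw [sub_zero, imageMass_congr (F := fun v => (shorten (Nat.zero_le n) v, agentPath i v))
    (F' := agentPath i) fun v' => ?_]
  simp only [Prod.mk.injEq, and_iff_right_iff_imp]
  exact fun _ => Subsingleton.elim _ _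

/-- The difference of the two sides is the total correlation of the prefix (`h1`) plus, for each
agent, the mutual information of the joint prefix and the agent's whole path given the agent's
prefix (`h2`). The agent's prefix is a function of either, so the pairs and triples collapse (`e2`,
`e3`, `e4`). -/
lemma sum_imgLogMass_zero_le {T n : ℕ} (h : T ≤ n) :
    ∑ v, G.prefixMass π n v * G.imgLogMass π (Nat.zero_le n) v ≤
      ∑ v, G.prefixMass π n v * G.imgLogMass π h v := by
  set p := G.prefixMass π n with hpdef
  have hp : ∀ v, 0 ≤ p v := G.prefixMass_nonneg π n
  have hp1 : ∑ v, p v = 1 := G.sum_prefixMass π n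
  have h1 := sum_mul_log_imageMass_pi_nonneg hp hp1
    (fun i (v : Fin n → JointStep S A) => shorten h (agentPath i v))
  have h2 := Finset.sum_nonneg fun i (_ : i ∈ Finset.univ) =>
    sum_mul_log_imageMass_submodular hp hp1 (shorten h) (agentPath i)
      (fun v : Fin n → JointStep S A => shorten h (agentPath i v))
  rw [Finset.sum_comm] at h2
  rw [← sub_nonneg, ← Finset.sum_sub_distrib]
  refine le_of_le_of_eq (add_nonneg h1 h2) ?_
  rw [← Finset.sum_add_distrib]
  refine Finset.sum_congr rfl fun v _ => ?_
  have e1 : imageMass p (fun v i => shorten h (agentPath i v)) (fun i => shorten h (agentPath i v))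
      = imageMass p (shorten h) (shorten h v) := by
    refine imageMass_congr (F := fun v i => shorten h (agentPath i v)) fun v' => ?_
    simp only [funext_iff, shorten, agentPath]
    exact ⟨fun h t i => h i t, fun h i t => h t i⟩
  have hsub : ∀ i (v' : Fin n → JointStep S A), shorten h v' = shorten h v →
      shorten h (agentPath i v') = shorten h (agentPath i v) :=
    fun i v' h' => funext fun t => congrFun (congrFun h' t) i
  have e2 : ∀ i, imageMass p
      (fun v => (shorten h v, agentPath i v, shorten h (agentPath i v)))
      (shorten h v, agentPath i v, shorten h (agentPath i v)) =
      imageMass p (fun v => (shorten h v, agentPath i v)) (shorten h v, agentPath i v) := by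
    intro i
    refine imageMass_congr
      (F := fun v => (shorten h v, agentPath i v, shorten h (agentPath i v)))
      (F' := fun v => (shorten h v, agentPath i v)) fun v' => ?_
    simp only [Prod.mk.injEq]
    exact ⟨fun h' => ⟨h'.1, h'.2.1⟩, fun h' => ⟨h'.1, h'.2, hsub i v' h'.1⟩⟩
  have e3 : ∀ i, imageMass p (fun v => (shorten h v, shorten h (agentPath i v)))
      (shorten h v, shorten h (agentPath i v)) = imageMass p (shorten h) (shorten h v) := by
    intro i
    refine imageMass_congr (F := fun v => (shorten h v, shorten h (agentPath i v))) fun v' => ?_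
    simp only [Prod.mk.injEq]
    exact ⟨fun h' => h'.1, fun h' => ⟨h', hsub i v' h'⟩⟩
  have e4 : ∀ i, imageMass p (fun v => (agentPath i v, shorten h (agentPath i v)))
      (agentPath i v, shorten h (agentPath i v)) =
      imageMass p (agentPath i) (agentPath i v) := by
    intro i
    refine imageMass_congr
      (F := fun v => (agentPath i v, shorten h (agentPath i v))) fun v' => ?_
    simp only [Prod.mk.injEq]
    exact ⟨fun h' => h'.1, fun h' => ⟨h', by rw [h']⟩⟩
  rw [imgLogMass_zero, imgLogMass, ← hpdef, e1]
  simp_rw [e2, e3, e4]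
  rw [← Finset.mul_sum]
  simp_rw [Finset.sum_sub_distrib, Finset.sum_add_distrib]
  ring

/-- Over a finite horizon, imaginary play is furthest from full communication if communication is
lost at once. -/
lemma klDiv_map_pathPrefix_le (n : ℕ) (τ : ℕ∞) :
    klDiv ((G.fullPathLaw π).map (pathPrefix n)) ((G.imgPathLaw π τ).map (pathPrefix n)) ≤
      klDiv ((G.fullPathLaw π).map (pathPrefix n)) ((G.imgPathLaw π 0).map (pathPrefix n)) := by
  obtain ⟨T, h, hT⟩ := exists_le_forall_lt_iff n τ
  obtain ⟨h1, h2⟩ := G.klDiv_map_pathPrefix π h τ hT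
  obtain ⟨h3, h4⟩ := G.klDiv_map_pathPrefix π (Nat.zero_le n) 0 (by simp)
  rw [← ENNReal.toReal_le_toReal h1 h3, h2, h4]
  simp_rw [mul_sub, Finset.sum_sub_distrib]
  have := G.sum_imgLogMass_zero_le π h
  linarith

lemma entropyGap_map_pathPrefix (n : ℕ) :
    entropyGap ((G.fullPathLaw π).map (pathPrefix n)) =
      ((klDiv ((G.fullPathLaw π).map (pathPrefix n))
        ((G.imgPathLaw π 0).map (pathPrefix n)) : ℝ≥0∞) : EReal) := by
  obtain ⟨h3, h4⟩ := G.klDiv_map_pathPrefix π (Nat.zero_le n) 0 (by simp)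
  rw [← EReal.coe_ennreal_toReal h3, h4, entropyGap]
  have h0 := shannonEntropy_map_of_fintype ((G.fullPathLaw π).map (pathPrefix n)) id
  rw [Measure.map_id] at h0
  have hi (i : ι) := shannonEntropy_map_of_fintype ((G.fullPathLaw π).map (pathPrefix n))
    fun v (t : Fin n) => v t i
  rw [h0, Finset.sum_congr rfl fun i _ => hi i, ← EReal.coe_sum_real, ← EReal.coe_sub]
  congr 1
  change ∑ i, -∑ v, G.prefixMass π n v *
      Real.log (imageMass (G.prefixMass π n) (agentPath i) (agentPath i v)) -
    -∑ v, G.prefixMass π n v * Real.log (imageMass (G.prefixMass π n) id v) = _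
  simp_rw [imageMass_id, imgLogMass_zero, mul_sub, Finset.mul_sum]
  rw [Finset.sum_sub_distrib, Finset.sum_neg_distrib, Finset.sum_comm]
  ring

end

end MarkovGame

/-! ### Entropy over an infinite horizon -/

lemma ae_measure_singleton_ne_zero {α : Type*} [MeasurableSpace α] (μ : Measure α)
    {s : Set α} (hs : s.Countable) (hμ : μ sᶜ = 0) : ∀ᵐ x ∂μ, μ {x} ≠ 0 := by
  rw [ae_iff]
  refine measure_mono_null (t := sᶜ ∪ ⋃ x ∈ s ∩ {x | μ {x} = 0}, {x}) ?_
    (measure_union_null hμ ((measure_biUnion_null_iff (hs.mono Set.inter_subset_left)).2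
      fun x hx => hx.2))
  intro x hx
  by_cases hxs : x ∈ s
  · exact Or.inr (Set.mem_biUnion (x := x) ⟨hxs, by simpa using hx⟩ rfl)
  · exact Or.inl hxs

/-- The entropy of a discrete law is the mean surprisal. -/
lemma shannonEntropy_eq_lintegral {α : Type*} [MeasurableSpace α] [MeasurableSingletonClass α]
    (μ : Measure α) [IsProbabilityMeasure μ] {s : Set α} (hs : s.Countable) (hμ : μ sᶜ = 0) :
    shannonEntropy μ = ∫⁻ x, ENNReal.ofReal (-Real.log (μ.real {x})) ∂μ := by
  have hrestr : μ.restrict s = μ := Measure.restrict_eq_self_of_ae_mem (by rwa [ae_iff])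
  rw [shannonEntropy, if_pos ⟨s, hs, hμ⟩]
  conv_rhs => rw [← hrestr]
  rw [lintegral_countable _ hs]
  have hsupp : Function.support (fun x => ENNReal.ofReal (Real.negMulLog (μ.real {x}))) ⊆ s := by
    intro x hx
    by_contra hxs
    have h0 : μ {x} = 0 := measure_mono_null (by simpa using hxs) hμ
    simp [measureReal_def, h0] at hx
  rw [← tsum_subtype_eq_of_support_subset hsupp]
  refine tsum_congr fun x => ?_
  rw [hrestr, ← ENNReal.ofReal_toReal (a := μ {(x : α)}) (by finiteness), ← measureReal_def,
    ← ENNReal.ofReal_mul (neg_nonneg.2 (Real.log_nonpos measureReal_nonneg measureReal_le_one)),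
    Real.negMulLog]
  congr 1
  ring

lemma shannonEntropy_map_eq_lintegral {α β : Type*} [MeasurableSpace α] [MeasurableSpace β]
    [MeasurableSingletonClass β] [Countable β] (μ : Measure α) [IsProbabilityMeasure μ]
    {F : α → β} (hF : Measurable F) :
    shannonEntropy (μ.map F) =
      ∫⁻ x, ENNReal.ofReal (-Real.log (μ.real (F ⁻¹' {F x}))) ∂μ := by
  have : IsProbabilityMeasure (μ.map F) := Measure.isProbabilityMeasure_map hF.aemeasurable
  rw [shannonEntropy_eq_lintegral (μ.map F) Set.countable_univ (by simp),
    lintegral_map (measurable_of_countable _) hF]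
  simp_rw [map_measureReal_apply hF (measurableSet_singleton _)]

/-- Coarser observations have larger fibres, hence smaller surprisal. This is used almost everywhere
only: on null fibres the convention `log 0 = 0` would break monotonicity. -/
lemma shannonEntropy_map_comp_le {α β γ : Type*} [MeasurableSpace α] [MeasurableSpace β]
    [MeasurableSingletonClass β] [Countable β] [MeasurableSpace γ] [MeasurableSingletonClass γ]
    [Countable γ] (μ : Measure α) [IsProbabilityMeasure μ] {F : α → β} (hF : Measurable F)
    (f : β → γ) : shannonEntropy (μ.map (f ∘ F)) ≤ shannonEntropy (μ.map F) := by
  rw [shannonEntropy_map_eq_lintegral μ hF,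
    shannonEntropy_map_eq_lintegral μ ((measurable_of_countable f).comp hF)]
  have : IsProbabilityMeasure (μ.map F) := Measure.isProbabilityMeasure_map hF.aemeasurable
  have hae := ae_of_ae_map hF.aemeasurable
    (ae_measure_singleton_ne_zero (μ.map F) Set.countable_univ (by simp))
  refine lintegral_mono_ae ?_
  filter_upwards [hae] with x hx
  rw [Measure.map_apply hF (measurableSet_singleton _)] at hx
  refine ENNReal.ofReal_le_ofReal (neg_le_neg (Real.log_le_log
    (ENNReal.toReal_pos hx (by finiteness)) (measureReal_mono ?_)))
  intro y hy
  simp only [Set.mem_preimage, Set.mem_singleton_iff, Function.comp_apply] at hy ⊢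
  rw [hy]

open Filter Topology in
/-- The entropy of a discrete process is the limit of the entropies over finite horizons. -/
lemma tendsto_shannonEntropy_map_pathPrefix {X : Type*} [MeasurableSpace X] [Countable X]
    [MeasurableSingletonClass X] (μ : Measure (ℕ → X)) [IsProbabilityMeasure μ] {s : Set (ℕ → X)}
    (hs : s.Countable) (hμ : μ sᶜ = 0) :
    Tendsto (fun n => shannonEntropy (μ.map (pathPrefix n))) atTop (𝓝 (shannonEntropy μ)) := by
  rw [shannonEntropy_eq_lintegral μ hs hμ]
  simp_rw [shannonEntropy_map_eq_lintegral μ (measurable_pathPrefix _), ← pathCylinder_eq_preimage]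
  have hinter : ∀ x : ℕ → X, ⋂ n, pathCylinder n x = {x} := by
    intro x
    ext ω
    simp only [Set.mem_iInter, Set.mem_singleton_iff, funext_iff]
    exact ⟨fun h t => h (t + 1) t (Nat.lt_succ_self t), fun h n t _ => h t⟩
  have hae := ae_measure_singleton_ne_zero μ hs hμ
  refine lintegral_tendsto_of_tendsto_of_monotone (fun n => ?_) ?_ ?_
  · simp_rw [pathCylinder_eq_preimage]
    exact ((measurable_of_countable fun v : Fin n → X =>
      ENNReal.ofReal (-Real.log (μ.real (pathPrefix n ⁻¹' {v})))).comp
        (measurable_pathPrefix n)).aemeasurable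
  · filter_upwards [hae] with x hx m n hmn
    refine ENNReal.ofReal_le_ofReal (neg_le_neg (Real.log_le_log
      (ENNReal.toReal_pos (fun h0 => hx (measure_mono_null ?_ h0)) (by finiteness))
      (measureReal_mono (pathCylinder_anti hmn x))))
    rw [← hinter x]
    exact Set.iInter_subset _ n
  · filter_upwards [hae] with x hx
    -- Continuity from above along the cylinders shrinking to `x`; the surprisals then increase to
    -- their limit and monotone convergence applies.
    have h1 : Tendsto (fun n => μ (pathCylinder n x)) atTop (𝓝 (μ {x})) := by
      rw [← hinter x]
      exact tendsto_measure_iInter_atTop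
        (fun n => (measurableSet_pathCylinder n x).nullMeasurableSet)
        (fun m n hmn => pathCylinder_anti hmn x) ⟨0, by finiteness⟩
    have h2 : Tendsto (fun n => μ.real (pathCylinder n x)) atTop (𝓝 (μ.real {x})) :=
      (ENNReal.tendsto_toReal (by finiteness)).comp h1
    exact ENNReal.tendsto_ofReal
      (h2.log (ENNReal.toReal_pos hx (by finiteness)).ne').neg

section

variable {ι : Type*} [Fintype ι] {S A : ι → Type*}
  [∀ i, MeasurableSpace (S i)] [∀ i, MeasurableSpace (A i)]

lemma entropyGap_eq_toReal {T : Type*} (μ : Measure (T → JointStep S A))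
    (h : shannonEntropy μ ≠ ∞) (hi : ∀ i, shannonEntropy (μ.map fun ω t => ω t i) ≠ ∞) :
    entropyGap μ = ((∑ i, (shannonEntropy (μ.map fun ω t => ω t i)).toReal -
      (shannonEntropy μ).toReal : ℝ) : EReal) := by
  rw [entropyGap, EReal.coe_sub, EReal.coe_sum_real, EReal.coe_ennreal_toReal h]
  simp_rw [fun i => EReal.coe_ennreal_toReal (hi i)]

open Filter Topology in
lemma tendsto_entropyGap [∀ i, Finite (S i)] [∀ i, Finite (A i)]
    [∀ i, MeasurableSingletonClass (S i)] [∀ i, MeasurableSingletonClass (A i)]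
    (P : Measure (ℕ → JointStep S A)) [IsProbabilityMeasure P] (h : shannonEntropy P ≠ ∞) :
    Tendsto (fun n => entropyGap (P.map (pathPrefix n))) atTop (𝓝 (entropyGap P)) := by
  obtain ⟨s, hs, hP⟩ : ∃ s : Set (ℕ → JointStep S A), s.Countable ∧ P sᶜ = 0 := by
    by_contra hcon
    exact h (if_neg hcon)
  have hlim := tendsto_shannonEntropy_map_pathPrefix P hs hP
  have hm : ∀ i, Measurable fun (ω : ℕ → JointStep S A) t => ω t i := fun i => by fun_prop
  have hpr : ∀ i, IsProbabilityMeasure (P.map fun ω t => ω t i) :=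
    fun i => Measure.isProbabilityMeasure_map (hm i).aemeasurable
  have hlimi (i : ι) : Tendsto (fun n => shannonEntropy ((P.map (pathPrefix n)).map
      fun ω t => ω t i)) atTop (𝓝 (shannonEntropy (P.map fun ω t => ω t i))) := by
    have hsi : ((fun (ω : ℕ → JointStep S A) t => ω t i) '' s).Countable := hs.image _
    have := tendsto_shannonEntropy_map_pathPrefix (P.map fun ω t => ω t i) hsi (by
      rw [Measure.map_apply (hm i) hsi.measurableSet.compl]
      exact measure_mono_null (fun x hx hxs => hx ⟨x, hxs, rfl⟩) hP)
    refine this.congr fun n => ?_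
    rw [Measure.map_map (measurable_pathPrefix n) (hm i),
      Measure.map_map (by fun_prop) (measurable_pathPrefix n)]
    rfl
  have hle : ∀ i n, shannonEntropy ((P.map (pathPrefix n)).map fun ω t => ω t i) ≤
      shannonEntropy (P.map (pathPrefix n)) := by
    intro i n
    rw [Measure.map_map (by fun_prop) (measurable_pathPrefix n)]
    exact shannonEntropy_map_comp_le P (measurable_pathPrefix n) _
  -- An agent's entropy is at most the joint entropy on each prefix, hence in the limit. With all
  -- entropies finite, the gap is a real difference and passes to the limit.
  have hfini : ∀ i, shannonEntropy (P.map fun ω t => ω t i) ≠ ∞ := fun i =>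
    ne_top_of_le_ne_top h (le_of_tendsto_of_tendsto' (hlimi i) hlim (hle i))
  have hfin : ∀ n, shannonEntropy (P.map (pathPrefix n)) ≠ ∞ := by
    intro n
    have := Fintype.ofFinite (JointStep S A)
    have : IsProbabilityMeasure (P.map (pathPrefix n)) :=
      Measure.isProbabilityMeasure_map (measurable_pathPrefix n).aemeasurable
    rw [shannonEntropy_of_fintype]
    exact ENNReal.ofReal_ne_top
  have hfinn : ∀ n i, shannonEntropy ((P.map (pathPrefix n)).map fun ω t => ω t i) ≠ ∞ :=
    fun n i => ne_top_of_le_ne_top (hfin n) (hle i n)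
  rw [entropyGap_eq_toReal P h hfini]
  simp_rw [fun n => entropyGap_eq_toReal (P.map (pathPrefix n)) (hfin n) (hfinn n)]
  refine (continuous_coe_real_ereal.tendsto _).comp ?_
  exact (tendsto_finsetSum _ fun i _ => (ENNReal.tendsto_toReal (hfini i)).comp (hlimi i)).sub
    ((ENNReal.tendsto_toReal h).comp hlim)

end

/-! ### The main theorem -/

theorem mainTheorem5 {ι : Type*} [Fintype ι] {S A : ι → Type*}
    [∀ i, Fintype (S i)] [∀ i, MeasurableSpace (S i)] [∀ i, DiscreteMeasurableSpace (S i)]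
    [∀ i, Fintype (A i)] [∀ i, MeasurableSpace (A i)] [∀ i, DiscreteMeasurableSpace (A i)]
    (G : MarkovGame S A) (π : JointPolicy S A) :
    (∀ tloss : ℕ∞, klDiv (G.fullPathLaw π) (G.imgPathLaw π tloss) ≤
      klDiv (G.fullPathLaw π) (G.imgPathLaw π 0)) ∧
    ((klDiv (G.fullPathLaw π) (G.imgPathLaw π 0) : ℝ≥0∞) : EReal) =
      totalCorrelation (G.fullPathLaw π) ∧
    (shannonEntropy (G.fullPathLaw π) ≠ ∞ →
      totalCorrelation (G.fullPathLaw π) = entropyGap (G.fullPathLaw π)) := by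
  have := Fintype.ofFinite (JointStep S A)
  have hmono : Monotone ((↑) : ℝ≥0∞ → EReal) :=
    fun _ _ h => EReal.coe_ennreal_le_coe_ennreal_iff.2 h
  have hgap : ∀ n, entropyGap ((G.fullPathLaw π).map fun ω (t : Fin n) => ω t) = _ :=
    G.entropyGap_map_pathPrefix π
  refine ⟨fun τ => ?_, ?_, fun h => ?_⟩
  · rw [klDiv_eq_iSup_pathPrefix, klDiv_eq_iSup_pathPrefix]
    exact iSup_mono fun n => G.klDiv_map_pathPrefix_le π n τ
  · rw [klDiv_eq_iSup_pathPrefix, hmono.map_ciSup_of_continuousAt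
      continuous_coe_ennreal_ereal.continuousAt (OrderTop.bddAbove _), totalCorrelation]
    simp_rw [hgap]
  -- The gaps are finite-horizon divergences, hence nondecreasing, so their limit is their supremum.
  · refine tendsto_nhds_unique (tendsto_atTop_iSup fun m n hmn => ?_)
      (tendsto_entropyGap (G.fullPathLaw π) h)
    rw [hgap, hgap]
    exact hmono (monotone_klDiv_pathPrefix _ _ hmn)

end
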